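/- Let $t_0,r\in\mathbb R$ and $S_0>0$, and let $\Phi$ be the standard normal distribution function. Let $BS_{c}(T,K;\sigma)$ and $BS_p(T,K;\sigma)$ be the Black–Scholes call and put prices at time $t_0$ with spot $S_0$, interest rate $r$, expiry $T$, strike $K$ and volatility $\sigma\ge 0$ (for $\sigma=0$: the discounted intrinsic value). Let $\hat\sigma(T,K;\overline p)\ge 0$ be an implied volatility parametrization on $\{T>t_0,\ K>0\}$ with parameters $\overline p\in\mathcal D\subset\mathbb R^d$, continuously differentiable in $(T,K)$. Let $\vartheta$ be an absolutely continuous real random variable with finite moments up to order $2N_q$, $N_q\ge 1$, let $\overline p(\theta)$ denote the vector $\overline p$ with its $i$-th entry replaced by $\theta$, and suppose that $\overline p(\vartheta)\in\mathcal D$ almost surely. Let $\{\lambda_n,\theta_n\}_{n=1}^{N_q}$ be the Gauss-quadrature weights and nodes of degree $N_q$ for the law of $\vartheta$: the $\theta_n$ are the roots of the orthonormal polynomial of degree $N_q$, and $\lambda_n=\mathbb E[\ell_n(\vartheta)]$ with $\ell_n$ the Lagrange basis polynomials at the nodes. Suppose that $\overline p(\theta_n)\in\mathcal D$ for all $n$.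 Fix $T>t_0$ and $K>0$, and put $\tau=T-t_0$, $\eta_n=\hat\sigma(T,K;\overline p(\theta_n))$ and $m(T,K)=\log\frac{S_0}{K}+r\tau$. Suppose that $\eta_n>0$ for all $n$. Then there is a function $P=P_{(T,K)}\colon\mathbb R\to(0,\infty)$ such that, for every $m\in\mathbb R$, $P(m)$ is the unique $\sigma>0$ with $$S_0\bigg[\Phi\Big(\frac{m+\frac12\sigma^2\tau}{\sigma\sqrt \tau}\Big)-e^{-m}\Phi\Big(\frac{m-\frac12\sigma^2\tau}{\sigma\sqrt \tau}\Big)\bigg]=S_0\sum_{n=1}^{N_q}\lambda_n\bigg[\Phi\Big(\frac{m+\frac12\eta_n^2\tau}{\eta_n\sqrt \tau}\Big)-e^{-m}\Phi\Big(\frac{m-\frac12\eta_n^2\tau}{\eta_n\sqrt \tau}\Big)\bigg].$$ The function $P$ is infinitely differentiable. The discretized randomization at $(T,K)$ is $P(m(T,K))$: both for calls and for puts, $\sigma=P(m(T,K))$ is the unique $\sigma\ge0$ with $BS_{c/p}(T,K;\sigma)=\sum_{n}\lambda_n BS_{c/p}(T,K;\eta_n)$. Moreover $P^{(k)}(0)=0$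 for $k=1,3,5,7$, and, as $m\to0$, $$P(m)=P(0)+\frac{P^{(2)}(0)}{2!}m^2+\frac{P^{(4)}(0)}{4!}m^4+\frac{P^{(6)}(0)}{6!}m^6+\mathcal O(m^8).$$ With $\Sigma_0=\frac12P(0)\sqrt \tau$, $\Sigma_2=P(0)P^{(2)}(0)\tau$, $\Sigma_4=P(0)P^{(4)}(0)\tau$, $H_n=\frac12\eta_n\sqrt \tau$ and $E_n=\exp\big(\frac12(\Sigma_0^2-H_n^2)\big)$, the coefficients are $$P(0)=\frac{2}{\sqrt \tau}\Phi^{-1}\Big(\sum_{n}\lambda_n\Phi\big(\tfrac12\eta_n\sqrt \tau\big)\Big),\qquad P^{(2)}(0)=\frac{1}{2\sqrt \tau}\Big\{-\frac1{\Sigma_0}+\sum_n\lambda_n\frac{E_n}{H_n}\Big\},$$ $$P^{(4)}(0)=\frac{1}{8\sqrt \tau}\Big\{\frac{1+6\Sigma_2+\Sigma_0^2(-7-6\Sigma_2+3\Sigma_2^2)}{\Sigma_0^3}+\sum_n\lambda_n\frac{E_n}{H_n^3}(-1+7H_n^2)\Big\},$$ $$\begin{aligned}P^{(6)}(0)=\frac{1}{32\sqrt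 \tau}\Big\{&\frac{-3-45\Sigma_2+\Sigma_0^2(90\Sigma_2+60\Sigma_4)+\Sigma_0^4\Sigma_2(45\Sigma_2+60\Sigma_4-15\Sigma_2^2)}{\Sigma_0^5}\\&+\frac{16\Sigma_0^2-90\Sigma_2^2-31\Sigma_0^4-45\Sigma_0^2\Sigma_2^2-\Sigma_0^4(15\Sigma_2+60\Sigma_4)+15\Sigma_0^2\Sigma_2^3}{\Sigma_0^5}\\&+\sum_n\lambda_n\frac{E_n}{H_n^5}(3-16H_n^2+31H_n^4)\Big\}.\end{aligned}$$ -/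

import Mathlib

open MeasureTheory ProbabilityTheory Filter Topology Asymptotics
open scoped ContDiff BigOperators

namespace RandVol

noncomputable section

/-- The standard normal distribution function. -/
def Phi (x : ℝ) : ℝ := cdf (gaussianReal 0 1) x

/-- The inverse of the standard normal distribution function; it is only meaningful on
the range `(0, 1)` of the injective function `Phi`. -/
def PhiInv : ℝ → ℝ := Function.invFun Phi

/-- The two types of vanilla European options. -/
inductive OptionType
  | call
  | put

/-- The quantity `d₊` of the Black-Scholes formula (`τ` is the time to expiry). -/
def dPlus (S0 r τ K σ : ℝ) : ℝ :=
  (Real.log (S0 / K) + (r + σ ^ 2 / 2) * τ) / (σ * Real.sqrt τ)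

/-- The quantity `d₋` of the Black-Scholes formula (`τ` is the time to expiry). -/
def dMinus (S0 r τ K σ : ℝ) : ℝ :=
  (Real.log (S0 / K) + (r - σ ^ 2 / 2) * τ) / (σ * Real.sqrt τ)

/-- The Black-Scholes price at time `t0` of a European option with expiry `T` and strike `K`,
for the spot price `S0`, the interest rate `r` and the volatility `σ`. For `σ = 0` it is
the discounted intrinsic value (the limit as `σ → 0`). -/
def bsPrice (o : OptionType) (r t0 S0 T K σ : ℝ) : ℝ :=
  match o with
  | .call =>
      if σ = 0 then max (S0 - K * Real.exp (-r * (T - t0))) 0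
      else S0 * Phi (dPlus S0 r (T - t0) K σ)
        - K * Real.exp (-r * (T - t0)) * Phi (dMinus S0 r (T - t0) K σ)
  | .put =>
      if σ = 0 then max (K * Real.exp (-r * (T - t0)) - S0) 0
      else K * Real.exp (-r * (T - t0)) * Phi (-dMinus S0 r (T - t0) K σ)
        - S0 * Phi (-dPlus S0 r (T - t0) K σ)

/-- A parametrized implied volatility function: for each parameter vector `p` in the parameter
domain, a nonnegative function of expiry `T > t0` and strike `K > 0` which is continuously
differentiable in `(T, K)`. -/
structure VolParametrization (t0 : ℝ) (d : ℕ) where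
  /-- the parameter domain -/
  domain : Set (Fin d → ℝ)
  /-- the volatility at expiry `T` and strike `K` for the parameter vector `p` -/
  vol : ℝ → ℝ → (Fin d → ℝ) → ℝ
  vol_nonneg : ∀ p ∈ domain, ∀ T K : ℝ, t0 < T → 0 < K → 0 ≤ vol T K p
  vol_contDiffOn : ∀ p ∈ domain,
    ContDiffOn ℝ 1 (fun x : ℝ × ℝ => vol x.1 x.2 p) (Set.Ioi t0 ×ˢ Set.Ioi 0)

/-- `lam n` and `θ n`, for `n < N`, are the weights and nodes of the Gauss quadrature of degree `N`
for the law `ν`: the nodes are the `N` distinct roots of the orthonormal polynomial of degree `N`,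
and the weights are the integrals of the associated Lagrange basis polynomials. -/
structure IsGaussQuadrature (ν : Measure ℝ) (N : ℕ) (lam θ : Fin N → ℝ) : Prop where
  nodes_injective : Function.Injective θ
  nodes_roots : ∃ p : Polynomial ℝ, p.natDegree = N ∧ (∫ x, p.eval x ^ 2 ∂ν) = 1 ∧
    (∀ q : Polynomial ℝ, q.degree < N → ∫ x, p.eval x * q.eval x ∂ν = 0) ∧
    ∀ x : ℝ, p.IsRoot x ↔ ∃ n, θ n = x
  weights_eq : ∀ n, lam n = ∫ x, (Lagrange.basis Finset.univ θ n).eval x ∂ν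

/-- The discretized pricing surface `∑ λₙ V(T, K; p(θₙ))` of the randomization of a
parametrization in the `i`-th parameter, where `p(θ)` is `p` with its `i`-th entry
replaced by `θ`. -/
def discretizedPrice {t0 : ℝ} {d N : ℕ} (o : OptionType) (r S0 : ℝ)
    (V : VolParametrization t0 d) (p : Fin d → ℝ) (i : Fin d) (lam θ : Fin N → ℝ)
    (T K : ℝ) : ℝ :=
  ∑ n, lam n * bsPrice o r t0 S0 T K (V.vol T K (Function.update p i (θ n)))

/-- `σ` is a value at `(T, K)` of the discretized randomization: a volatility `σ ≥ 0` with which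
the Black-Scholes formula gives the discretized price. -/
def IsDiscretizedRandomizationAt {t0 : ℝ} {d N : ℕ} (o : OptionType) (r S0 : ℝ)
    (V : VolParametrization t0 d) (p : Fin d → ℝ) (i : Fin d) (lam θ : Fin N → ℝ)
    (T K σ : ℝ) : Prop :=
  0 ≤ σ ∧ bsPrice o r t0 S0 T K σ = discretizedPrice o r S0 V p i lam θ T K

/-- The log-moneyness `log (S₀ / K) + r τ`, with `τ = T - t0` the time to expiry. -/
def logMoneyness (r t0 S0 T K : ℝ) : ℝ := Real.log (S0 / K) + r * (T - t0)

/-- The Black-Scholes call price as a function of the log-moneyness `m` and the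
volatility `σ > 0`, for the time to expiry `τ`. -/
def bsMoneyness (S0 τ m σ : ℝ) : ℝ :=
  S0 * (Phi ((m + σ ^ 2 * τ / 2) / (σ * Real.sqrt τ))
    - Real.exp (-m) * Phi ((m - σ ^ 2 * τ / 2) / (σ * Real.sqrt τ)))

/-- The mixture of Black-Scholes call prices with volatilities `η n` and weights `lam n`, as a
function of the log-moneyness. -/
def mixMoneyness {N : ℕ} (S0 τ : ℝ) (lam η : Fin N → ℝ) (m : ℝ) : ℝ :=
  S0 * ∑ n, lam n * (Phi ((m + η n ^ 2 * τ / 2) / (η n * Real.sqrt τ))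
    - Real.exp (-m) * Phi ((m - η n ^ 2 * τ / 2) / (η n * Real.sqrt τ)))

end

end RandVol

/-! Put `s = σ√τ / 2`. Divided by spot, the call price becomes `unitCall m s`, whose vega is
positive. The Gauss weights are nonnegative with sum one, so a mixture lies between its extreme
components, and the intermediate value theorem gives a unique `S m > 0` matching it
(`exists_unitCall_eq_unitMix`). The implicit function theorem makes `S` smooth; put-call symmetry `m
↦ -m` makes it even, which kills the odd derivatives.

For the coefficients, let `g m = exp (m / 2) * unitCall m (S m)`. In `g'' - g / 4` every `Phi`
cancels, leaving a Gaussian kernel times a rational expression in `m, S, S', S''`. The same operator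
applied to each component, where `S` is constant, yields a differential equation free of `Phi`
(`vegaKernel_mul_curvatureFactor`). Comparing its coefficients of `m ^ 0, m ^ 2, m ^ 4` gives the
derivatives of orders 2, 4, 6 in turn (`iteratedDeriv_impliedVol`); order 0 is the equation at `m =
0`. Finally `P = 2 S / √τ`. -/

namespace RandVol

/-! ### Standard normal density and distribution function. -/

/-- The standard normal density. -/
noncomputable def phi (x : ℝ) : ℝ := (Real.sqrt (2 * Real.pi))⁻¹ * Real.exp (-x ^ 2 / 2)

lemma phi_pos (x : ℝ) : 0 < phi x := by
  unfold phi
  have : 0 < Real.pi := Real.pi_pos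
  positivity

lemma gaussianPDFReal_eq_phi : gaussianPDFReal 0 1 = phi := by
  funext x
  simp [gaussianPDFReal, phi]

lemma contDiff_phi : ContDiff ℝ ∞ phi := by
  unfold phi
  fun_prop

lemma Phi_eq_integral (x : ℝ) : Phi x = ∫ y in Set.Iic x, phi y := by
  rw [Phi, cdf_eq_real, measureReal_def, gaussianReal_apply_eq_integral 0 one_ne_zero,
    gaussianPDFReal_eq_phi, ENNReal.toReal_ofReal]
  exact integral_nonneg fun y => (phi_pos y).le

lemma integrable_phi : Integrable phi := by
  rw [← gaussianPDFReal_eq_phi]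
  exact integrable_gaussianPDFReal 0 1

lemma hasDerivAt_Phi (x : ℝ) : HasDerivAt Phi (phi x) x := by
  have h : Phi = fun y => (∫ t in (0 : ℝ)..y, phi t) + Phi 0 := by
    funext y
    rw [Phi_eq_integral, Phi_eq_integral, ← intervalIntegral.integral_Iic_sub_Iic
      integrable_phi.integrableOn integrable_phi.integrableOn]
    ring
  rw [h]
  exact (intervalIntegral.integral_hasDerivAt_right (integrable_phi.intervalIntegrable)
    contDiff_phi.continuous.stronglyMeasurable.stronglyMeasurableAtFilter
    contDiff_phi.continuous.continuousAt).add_const _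

lemma contDiff_Phi : ContDiff ℝ ∞ Phi := by
  rw [contDiff_infty_iff_deriv]
  refine ⟨fun x => (hasDerivAt_Phi x).differentiableAt, ?_⟩
  have : deriv Phi = phi := funext fun x => (hasDerivAt_Phi x).deriv
  rw [this]
  exact contDiff_phi

lemma strictMono_Phi : StrictMono Phi :=
  strictMono_of_hasDerivAt_pos hasDerivAt_Phi phi_pos

lemma tendsto_Phi_atBot : Tendsto Phi atBot (𝓝 0) := tendsto_cdf_atBot _

lemma tendsto_Phi_atTop : Tendsto Phi atTop (𝓝 1) := tendsto_cdf_atTop _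

lemma Phi_nonneg (x : ℝ) : 0 ≤ Phi x := cdf_nonneg _ x

lemma Phi_neg (x : ℝ) : Phi (-x) = 1 - Phi x := by
  have hd : ∀ y, HasDerivAt (fun y => Phi y + Phi (-y)) 0 y := by
    intro y
    have h := (hasDerivAt_Phi y).add ((hasDerivAt_Phi (-y)).comp y (hasDerivAt_neg y))
    have e : phi y + phi (-y) * -1 = 0 := by simp [phi]
    rw [e] at h
    exact h
  have hc : ∀ y, Phi y + Phi (-y) = Phi x + Phi (-x) := fun y =>
    is_const_of_deriv_eq_zero (fun z => (hd z).differentiableAt) (fun z => (hd z).deriv) y x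
  have hl : Tendsto (fun y => Phi y + Phi (-y)) atTop (𝓝 (1 + 0)) :=
    tendsto_Phi_atTop.add (tendsto_Phi_atBot.comp tendsto_neg_atTop_atBot)
  simp_rw [hc] at hl
  have := tendsto_nhds_unique hl tendsto_const_nhds
  linarith

/-! ### The normalized call price: vega, symmetry, bounds. -/

/-- The Black-Scholes call price for unit spot in terms of the log-moneyness `m` and half of the
total volatility `s`. -/
noncomputable def unitCall (m s : ℝ) : ℝ :=
  Phi (m / (2 * s) + s) - Real.exp (-m) * Phi (m / (2 * s) - s)

/-- The squares of the two arguments differ by `2 * m`. This identity collapses the vega to a single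
positive term. -/
lemma exp_neg_mul_phi (m : ℝ) {s : ℝ} (hs : s ≠ 0) :
    Real.exp (-m) * phi (m / (2 * s) - s) = phi (m / (2 * s) + s) := by
  unfold phi
  rw [mul_left_comm, ← Real.exp_add]
  congr 2
  field_simp
  ring

lemma hasDerivAt_unitCall (m : ℝ) {s : ℝ} (hs : s ≠ 0) :
    HasDerivAt (unitCall m) (2 * phi (m / (2 * s) + s)) s := by
  have h1 : HasDerivAt (fun s : ℝ => m / (2 * s)) (-m / (2 * s ^ 2)) s := by
    have := ((hasDerivAt_id s).const_mul 2).inv (by simpa using hs) |>.const_mul m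
    refine this.congr_deriv ?_
    simp
    field_simp
  have h2 : HasDerivAt (fun s : ℝ => m / (2 * s) + s) (-m / (2 * s ^ 2) + 1) s :=
    h1.add (hasDerivAt_id s)
  have h3 : HasDerivAt (fun s : ℝ => m / (2 * s) - s) (-m / (2 * s ^ 2) - 1) s :=
    h1.sub (hasDerivAt_id s)
  have h4 := ((hasDerivAt_Phi _).comp s h2).sub
    (((hasDerivAt_Phi _).comp s h3).const_mul (Real.exp (-m)))
  refine HasDerivAt.congr_deriv (f := unitCall m) h4 ?_
  rw [← mul_assoc, exp_neg_mul_phi m hs]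
  ring

lemma strictMonoOn_unitCall (m : ℝ) : StrictMonoOn (unitCall m) (Set.Ioi 0) := by
  refine strictMonoOn_of_deriv_pos (convex_Ioi 0)
    (fun s hs => (hasDerivAt_unitCall m (ne_of_gt hs)).continuousAt.continuousWithinAt) ?_
  intro s hs
  rw [interior_Ioi] at hs
  rw [(hasDerivAt_unitCall m (ne_of_gt hs)).deriv]
  have := phi_pos (m / (2 * s) + s)
  positivity

/-- Changing the sign of `m` swaps the two arguments of `Phi` up to sign: put-call parity combined
with put-call symmetry. The evenness of the implied volatility rests on it. -/
lemma unitCall_neg (m s : ℝ) : unitCall (-m) s = 1 - Real.exp m + Real.exp m * unitCall m s := by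
  have e1 : -m / (2 * s) + s = -(m / (2 * s) - s) := by ring
  have e2 : -m / (2 * s) - s = -(m / (2 * s) + s) := by ring
  have e3 : Real.exp m * Real.exp (-m) = 1 := by rw [← Real.exp_add]; simp
  unfold unitCall
  rw [e1, e2, Phi_neg, Phi_neg, neg_neg]
  linear_combination Phi (m / (2 * s) - s) * e3

/-- For `m < 0` the price decreases to a nonnegative limit as the volatility shrinks: `m / (2 * t) →
-∞` as `t → 0+`, which kills the only negative term. -/
lemma unitCall_nonneg_of_nonpos {m s : ℝ} (hm : m ≤ 0) (hs : 0 < s) : 0 ≤ unitCall m s := by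
  rcases hm.eq_or_lt with rfl | hm
  · have := strictMono_Phi.monotone (show 0 / (2 * s) - s ≤ 0 / (2 * s) + s by linarith)
    simpa [unitCall] using this
  · have ht : Tendsto (fun t : ℝ => -(Real.exp (-m) * Phi (m / 2 * t⁻¹))) (𝓝[>] 0)
        (𝓝 (-(Real.exp (-m) * 0))) :=
      ((tendsto_Phi_atBot.comp (tendsto_inv_nhdsGT_zero.const_mul_atTop_of_neg
        (by linarith : m / 2 < 0))).const_mul _).neg
    have hle : ∀ᶠ t in 𝓝[>] (0 : ℝ), -(Real.exp (-m) * Phi (m / 2 * t⁻¹)) ≤ unitCall m s := by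
      filter_upwards [Ioo_mem_nhdsGT hs] with t ht
      have h1 := (strictMonoOn_unitCall m).monotoneOn (Set.mem_Ioi.2 ht.1) (Set.mem_Ioi.2 hs)
        ht.2.le
      have h2 : Phi (m / (2 * t) - t) ≤ Phi (m / 2 * t⁻¹) := by
        apply strictMono_Phi.monotone
        have : m / (2 * t) = m / 2 * t⁻¹ := by field_simp
        linarith [ht.1]
      have h3 := mul_le_mul_of_nonneg_left h2 (Real.exp_pos (-m)).le
      have h4 := Phi_nonneg (m / (2 * t) + t)
      unfold unitCall at h1 ⊢
      linarith
    simpa using le_of_tendsto ht hle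

lemma unitCall_nonneg (m : ℝ) {s : ℝ} (hs : 0 < s) : 0 ≤ unitCall m s := by
  rcases le_total m 0 with hm | hm
  · exact unitCall_nonneg_of_nonpos hm hs
  · have h1 := unitCall_nonneg_of_nonpos (neg_nonpos.2 hm) hs
    rw [unitCall_neg] at h1
    have h2 := Real.one_le_exp hm
    have h3 : 0 ≤ Real.exp m * unitCall m s := by linarith
    exact nonneg_of_mul_nonneg_right h3 (Real.exp_pos m)

lemma unitCall_pos (m : ℝ) {s : ℝ} (hs : 0 < s) : 0 < unitCall m s :=
  (unitCall_nonneg m (half_pos hs)).trans_lt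
    (strictMonoOn_unitCall m (Set.mem_Ioi.2 (half_pos hs)) (Set.mem_Ioi.2 hs) (half_lt_self hs))

lemma one_sub_exp_lt_unitCall (m : ℝ) {s : ℝ} (hs : 0 < s) :
    1 - Real.exp (-m) < unitCall m s := by
  have h1 := unitCall_pos (-m) hs
  have h2 := unitCall_neg (-m) s
  rw [neg_neg] at h2
  rw [h2]
  have := mul_pos (Real.exp_pos (-m)) h1
  linarith

/-- Strictness is what later rules out the volatility `σ = 0`. -/
lemma intrinsic_lt_unitCall (m : ℝ) {s : ℝ} (hs : 0 < s) :
    max (1 - Real.exp (-m)) 0 < unitCall m s :=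
  max_lt (one_sub_exp_lt_unitCall m hs) (unitCall_pos m hs)

lemma contDiffAt_unitCall (m : ℝ) {s : ℝ} (hs : s ≠ 0) :
    ContDiffAt ℝ ∞ (fun x : ℝ × ℝ => unitCall x.1 x.2) (m, s) := by
  have hq : ContDiffAt ℝ ∞ (fun x : ℝ × ℝ => x.1 / (2 * x.2)) (m, s) := by
    refine ContDiffAt.div contDiffAt_fst (contDiffAt_const.mul contDiffAt_snd) ?_
    simpa using hs
  unfold unitCall
  exact (contDiff_Phi.contDiffAt.comp (m, s) (hq.add contDiffAt_snd)).sub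
    (contDiffAt_fst.neg.exp.mul (contDiff_Phi.contDiffAt.comp (m, s) (hq.sub contDiffAt_snd)))

/-! ### Gauss quadrature weights. -/

lemma integrable_polynomial_eval {ν : Measure ℝ} {M : ℕ}
    (hmom : ∀ k ≤ M, Integrable (fun x : ℝ => x ^ k) ν) {q : Polynomial ℝ}
    (hq : q.natDegree ≤ M) : Integrable (fun x => q.eval x) ν := by
  simp_rw [Polynomial.eval_eq_sum_range]
  refine integrable_finsetSum _ fun k hk => (hmom k ?_).const_mul _
  exact (Nat.lt_succ_iff.1 (Finset.mem_range.1 hk)).trans hq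

namespace IsGaussQuadrature

variable {ν : Measure ℝ} {N : ℕ} {lam θ : Fin N → ℝ}

lemma sum_weights [IsProbabilityMeasure ν] (h : IsGaussQuadrature ν N lam θ) (hN : 1 ≤ N)
    (hmom : ∀ k ≤ 2 * N, Integrable (fun x : ℝ => x ^ k) ν) : ∑ n, lam n = 1 := by
  have : Nonempty (Fin N) := ⟨⟨0, hN⟩⟩
  have hinj : Set.InjOn θ (Finset.univ : Finset (Fin N)) := h.nodes_injective.injOn
  simp_rw [h.weights_eq]
  rw [← integral_finsetSum]
  · have hsum := Lagrange.sum_basis hinj Finset.univ_nonempty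
    have : ∀ x : ℝ, ∑ n, (Lagrange.basis Finset.univ θ n).eval x = 1 := by
      intro x
      rw [← Polynomial.eval_finsetSum, hsum, Polynomial.eval_one]
    simp [this]
  · intro n _
    refine integrable_polynomial_eval hmom ?_
    rw [Lagrange.natDegree_basis hinj (Finset.mem_univ n), Finset.card_univ, Fintype.card_fin]
    omega

/-- The classical argument: `l ^ 2 - l` vanishes at all nodes, so it is `p * q` with `q` of degree
below `N`. Orthogonality gives `∫ l = ∫ l ^ 2 ≥ 0`. -/
lemma weights_nonneg (h : IsGaussQuadrature ν N lam θ)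
    (hmom : ∀ k ≤ 2 * N, Integrable (fun x : ℝ => x ^ k) ν) (n : Fin N) : 0 ≤ lam n := by
  have hinj : Set.InjOn θ (Finset.univ : Finset (Fin N)) := h.nodes_injective.injOn
  obtain ⟨p, hdeg, -, horth, hroot⟩ := h.nodes_roots
  have hN : 0 < N := n.pos
  have hp0 : p ≠ 0 := by
    rintro rfl
    simp at hdeg
    omega
  have hpd : p.degree = N := by rw [Polynomial.degree_eq_natDegree hp0, hdeg]
  set l := Lagrange.basis Finset.univ θ n with hl
  have hld : l.natDegree = N - 1 := by
    rw [hl, Lagrange.natDegree_basis hinj (Finset.mem_univ n), Finset.card_univ, Fintype.card_fin]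
  have hsq : (l ^ 2).natDegree ≤ 2 * N - 2 := by
    refine Polynomial.natDegree_pow_le.trans ?_
    omega
  have hfd : (l ^ 2 - l).natDegree ≤ 2 * N - 2 := by
    refine (Polynomial.natDegree_sub_le _ _).trans (max_le hsq ?_)
    omega
  -- The remainder has degree below `N` but vanishes at `N` distinct nodes.
  have hmod : (l ^ 2 - l) % p = 0 := by
    refine Polynomial.eq_zero_of_degree_lt_of_eval_index_eq_zero (s := Finset.univ) (v := θ) hinj ?_ ?_
    · rw [Finset.card_univ, Fintype.card_fin, ← hpd]
      exact EuclideanDomain.mod_lt _ hp0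
    · intro k _
      have h1 : ((l ^ 2 - l) % p).eval (θ k) = (l ^ 2 - l).eval (θ k) := by
        conv_rhs => rw [← EuclideanDomain.div_add_mod (l ^ 2 - l) p]
        have : p.eval (θ k) = 0 := (hroot (θ k)).2 ⟨k, rfl⟩
        simp [this]
      rw [h1]
      rcases eq_or_ne n k with rfl | hnk
      · simp [hl, Lagrange.eval_basis_self hinj (Finset.mem_univ n)]
      · simp [hl, Lagrange.eval_basis_of_ne hnk (Finset.mem_univ k)]
  obtain ⟨q, hq⟩ := (EuclideanDomain.mod_eq_zero).1 hmod
  have hqd : q.degree < N := by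
    rcases eq_or_ne q 0 with rfl | hq0
    · rw [Polynomial.degree_zero]
      exact WithBot.bot_lt_coe N
    · rw [Polynomial.degree_eq_natDegree hq0]
      have := Polynomial.natDegree_mul hp0 hq0
      rw [← hq, hdeg] at this
      exact_mod_cast (by omega : q.natDegree < N)
  have hint : ∫ x, (l ^ 2 - l).eval x ∂ν = 0 := by
    rw [hq]
    simpa using horth q hqd
  have hsub : ∫ x, (l ^ 2).eval x ∂ν - ∫ x, l.eval x ∂ν = 0 := by
    rw [← integral_sub (integrable_polynomial_eval hmom (by omega))
      (integrable_polynomial_eval hmom (by omega))]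
    simpa using hint
  rw [h.weights_eq, ← hl, ← sub_eq_zero.1 hsub]
  exact integral_nonneg fun x => by simp [sq_nonneg]

end IsGaussQuadrature

/-! ### Implied volatility of a mixture: existence, smoothness, evenness. -/

/-- A mixture of unit call prices. -/
noncomputable def unitMix {N : ℕ} (lam H : Fin N → ℝ) (m : ℝ) : ℝ :=
  ∑ n, lam n * unitCall m (H n)

section

variable {N : ℕ} {lam H : Fin N → ℝ}

lemma unitMix_neg (hsum : ∑ n, lam n = 1) (m : ℝ) :
    unitMix lam H (-m) = 1 - Real.exp m + Real.exp m * unitMix lam H m := by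
  have : 1 - Real.exp m = ∑ n, lam n * (1 - Real.exp m) := by
    rw [← Finset.sum_mul, hsum, one_mul]
  unfold unitMix
  rw [this, Finset.mul_sum, ← Finset.sum_add_distrib]
  refine Finset.sum_congr rfl fun n _ => ?_
  rw [unitCall_neg]
  ring

lemma contDiff_unitCall_left {s : ℝ} (hs : s ≠ 0) : ContDiff ℝ ∞ fun m => unitCall m s :=
  contDiff_iff_contDiffAt.2 fun m =>
    (contDiffAt_unitCall m hs).comp m (contDiffAt_id.prodMk contDiffAt_const)

lemma contDiff_unitMix (hH : ∀ n, 0 < H n) : ContDiff ℝ ∞ (unitMix lam H) :=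
  ContDiff.sum fun n _ => contDiff_const.mul (contDiff_unitCall_left (hH n).ne')

lemma exists_unitCall_eq_unitMix (hlam : ∀ n, 0 ≤ lam n) (hsum : ∑ n, lam n = 1)
    (hH : ∀ n, 0 < H n) (m : ℝ) : ∃ s, 0 < s ∧ unitCall m s = unitMix lam H m := by
  have hne : Nonempty (Fin N) := by
    by_contra hne
    rw [not_nonempty_iff] at hne
    simp at hsum
  obtain ⟨a, ha⟩ := Finite.exists_min H
  obtain ⟨b, hb⟩ := Finite.exists_max H
  have hmono := (strictMonoOn_unitCall m).monotoneOn
  have hle : ∀ c : ℝ, c = ∑ n, lam n * c := fun c => by rw [← Finset.sum_mul, hsum, one_mul]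
  have h1 : unitCall m (H a) ≤ unitMix lam H m := by
    rw [hle (unitCall m (H a))]
    exact Finset.sum_le_sum fun n _ =>
      mul_le_mul_of_nonneg_left (hmono (hH a) (hH n) (ha n)) (hlam n)
  have h2 : unitMix lam H m ≤ unitCall m (H b) := by
    rw [hle (unitCall m (H b))]
    exact Finset.sum_le_sum fun n _ =>
      mul_le_mul_of_nonneg_left (hmono (hH n) (hH b) (hb n)) (hlam n)
  have hcont : ContinuousOn (unitCall m) (Set.Icc (H a) (H b)) := fun s hs =>
    (hasDerivAt_unitCall m ((hH a).trans_le hs.1).ne').continuousAt.continuousWithinAt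
  obtain ⟨s, hs, he⟩ := intermediate_value_Icc (ha b) hcont ⟨h1, h2⟩
  exact ⟨s, (hH a).trans_le hs.1, he⟩

lemma unitCall_injOn (m : ℝ) {s t : ℝ} (hs : 0 < s) (ht : 0 < t)
    (h : unitCall m s = unitCall m t) : s = t :=
  (strictMonoOn_unitCall m).injOn hs ht h

/-- Since the vega is nonzero, there is a smooth local implicit function; uniqueness of the positive
solution identifies it with `S`, with no continuity of `S` assumed beforehand. -/
lemma contDiff_of_unitCall_eq {f S : ℝ → ℝ} (hf : ContDiff ℝ ∞ f) (hS : ∀ m, 0 < S m)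
    (heq : ∀ m, unitCall m (S m) = f m) : ContDiff ℝ ∞ S := by
  rw [contDiff_iff_contDiffAt]
  intro m
  have hs := (hS m).ne'
  let G : ℝ × ℝ → ℝ := fun x => unitCall x.1 x.2 - f x.1
  have hG : ContDiffAt ℝ ∞ G (m, S m) :=
    (contDiffAt_unitCall m hs).sub (hf.contDiffAt.comp (m, S m) contDiffAt_fst)
  have hinfty : (∞ : WithTop ℕ∞) ≠ 0 := by simp
  have hderiv : fderiv ℝ G (m, S m) (0, 1) = 2 * phi (m / (2 * S m) + S m) := by
    have h1 : HasDerivAt (fun s => G (m, s)) (fderiv ℝ G (m, S m) (0, 1)) (S m) :=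
      (hG.differentiableAt hinfty).hasFDerivAt.comp_hasDerivAt (S m)
        ((hasDerivAt_const (S m) m).prodMk (hasDerivAt_id (S m)))
    exact h1.unique ((hasDerivAt_unitCall m hs).sub_const (f m))
  have hpos : (0 : ℝ) < 2 * phi (m / (2 * S m) + S m) := by
    have := phi_pos (m / (2 * S m) + S m)
    positivity
  have hinv : (fderiv ℝ G (m, S m) ∘L .inr ℝ ℝ ℝ).IsInvertible := by
    refine ⟨ContinuousLinearEquiv.unitsEquivAut ℝ (Units.mk0 _ hpos.ne'), ?_⟩
    ext
    simp [hderiv]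
  have hψ := hG.contDiffAt_implicitFunction hinfty hinv
  refine hψ.congr_of_eventuallyEq ?_
  have h0 : hG.implicitFunction hinfty hinv m = S m := hG.implicitFunction_apply_self hinfty hinv
  -- Uniqueness holds only among positive solutions, so positivity is first propagated to a
  -- neighbourhood.
  have hpos' : ∀ᶠ x in 𝓝 m, 0 < hG.implicitFunction hinfty hinv x :=
    hψ.continuousAt.eventually (lt_mem_nhds (by simpa [h0] using hS m))
  filter_upwards [hpos', hG.eventually_apply_implicitFunction hinfty hinv] with x hx1 hx2
  have hGm : G (m, S m) = 0 := by simp [G, heq]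
  rw [hGm] at hx2
  refine unitCall_injOn x (hS x) hx1 ?_
  rw [heq]
  exact (sub_eq_zero.1 hx2).symm

lemma exists_impliedVol (hlam : ∀ n, 0 ≤ lam n) (hsum : ∑ n, lam n = 1) (hH : ∀ n, 0 < H n) :
    ∃ S : ℝ → ℝ, (∀ m, 0 < S m) ∧ (∀ m, unitCall m (S m) = unitMix lam H m) ∧
      ContDiff ℝ ∞ S ∧ ∀ m, S (-m) = S m := by
  choose S hS heq using exists_unitCall_eq_unitMix hlam hsum hH
  refine ⟨S, hS, heq, contDiff_of_unitCall_eq (contDiff_unitMix hH) hS heq, fun m => ?_⟩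
  -- By symmetry `S m` also solves the equation at `-m`, since call and mixture transform by the
  -- same affine map.
  refine unitCall_injOn (-m) (hS _) (hS _) ?_
  rw [heq, unitMix_neg hsum, unitCall_neg, heq]

end

/-! ### Elimination of `Phi`: the differential equation for the implied volatility. -/

/-- Up to the factor `√(2π)`, half of the `s`-derivative of `exp (m / 2) * unitCall m s`. -/
noncomputable def vegaKernel (m s : ℝ) : ℝ := Real.exp (-s ^ 2 / 2 - m ^ 2 * (s⁻¹) ^ 2 / 8)

lemma exp_mul_phi_add (m : ℝ) {s : ℝ} (hs : s ≠ 0) :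
    Real.exp (m / 2) * phi (m / (2 * s) + s) = (Real.sqrt (2 * Real.pi))⁻¹ * vegaKernel m s := by
  unfold phi vegaKernel
  rw [mul_left_comm, ← Real.exp_add]
  congr 2
  field_simp
  ring

lemma exp_mul_phi_sub (m : ℝ) {s : ℝ} (hs : s ≠ 0) :
    Real.exp (-m / 2) * phi (m / (2 * s) - s) = (Real.sqrt (2 * Real.pi))⁻¹ * vegaKernel m s := by
  unfold phi vegaKernel
  rw [mul_left_comm, ← Real.exp_add]
  congr 2
  field_simp
  ring

section

variable {S S₁ S₂ : ℝ → ℝ}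

/-- The first derivative of `exp (m / 2) * unitCall m (S m)` if `S` has the derivative `S₁`. -/
noncomputable def symCallDeriv (S S₁ : ℝ → ℝ) (m : ℝ) : ℝ :=
  1 / 2 * (Real.exp (m / 2) * Phi (m / (2 * S m) + S m)
    + Real.exp (-m / 2) * Phi (m / (2 * S m) - S m))
    + 2 * ((Real.sqrt (2 * Real.pi))⁻¹ * vegaKernel m (S m)) * S₁ m

/-- The factor in `g'' - g / 4` for `g m = exp (m / 2) * unitCall m (S m)` if `S` has the
derivatives `S₁` and `S₂`. -/
noncomputable def curvatureFactor (S S₁ S₂ : ℝ → ℝ) (m : ℝ) : ℝ :=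
  1 / 2 * (S m)⁻¹ - (m * S₁ m) * ((S m)⁻¹ * (S m)⁻¹)
    + (1 / 2 * (m * m) * ((S m)⁻¹ * ((S m)⁻¹ * (S m)⁻¹)) - 2 * S m) * (S₁ m * S₁ m) + 2 * S₂ m

lemma hasDerivAt_quotient {m : ℝ} (hS : S m ≠ 0) (h1 : HasDerivAt S (S₁ m) m) :
    HasDerivAt (fun m => m / (2 * S m)) ((S m - m * S₁ m) / (2 * S m ^ 2)) m := by
  refine ((hasDerivAt_id m).div (h1.const_mul 2) (by simpa using hS)).congr_deriv ?_
  simp only [id]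
  field_simp

lemma hasDerivAt_exp_half (m : ℝ) :
    HasDerivAt (fun m : ℝ => Real.exp (m / 2)) (Real.exp (m / 2) * (1 / 2)) m :=
  ((hasDerivAt_id m).div_const 2).exp

lemma hasDerivAt_exp_neg_half (m : ℝ) :
    HasDerivAt (fun m : ℝ => Real.exp (-m / 2)) (Real.exp (-m / 2) * (-1 / 2)) m :=
  ((hasDerivAt_id m).neg.div_const 2).exp

lemma hasDerivAt_vegaKernel {m : ℝ} (hS : S m ≠ 0) (h1 : HasDerivAt S (S₁ m) m) :
    HasDerivAt (fun m => vegaKernel m (S m)) (vegaKernel m (S m) *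
      (-S m * S₁ m - m * (S m)⁻¹ ^ 2 / 4 + m ^ 2 * S₁ m * (S m)⁻¹ ^ 3 / 4)) m := by
  have h := (((h1.pow 2).neg.div_const 2).sub
    (((hasDerivAt_pow 2 m).mul ((h1.inv hS).pow 2)).div_const 8)).exp
  refine HasDerivAt.congr_deriv (f := fun m => vegaKernel m (S m)) h ?_
  simp only [vegaKernel, Pi.neg_apply, Pi.pow_apply, Pi.mul_apply, Pi.inv_apply]
  congr 1
  push_cast
  field_simp
  ring

/-- With the factor `exp (m / 2)` both density terms carry the same kernel, so the derivative of `m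
/ (2 * S m)` cancels and only that of `S` survives. -/
lemma hasDerivAt_symCall {m : ℝ} (hS : S m ≠ 0) (h1 : HasDerivAt S (S₁ m) m) :
    HasDerivAt (fun m => Real.exp (m / 2) * unitCall m (S m)) (symCallDeriv S S₁ m) m := by
  have hq := hasDerivAt_quotient hS h1
  have hp : HasDerivAt (fun m => m / (2 * S m) + S m) _ m := hq.add h1
  have hm : HasDerivAt (fun m => m / (2 * S m) - S m) _ m := hq.sub h1
  have h := ((hasDerivAt_exp_half m).mul ((hasDerivAt_Phi _).comp m hp)).sub
    ((hasDerivAt_exp_neg_half m).mul ((hasDerivAt_Phi _).comp m hm))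
  have he : ∀ m : ℝ, Real.exp (m / 2) * Real.exp (-m) = Real.exp (-m / 2) := fun m => by
    rw [← Real.exp_add]; ring_nf
  have hfun : (fun m => Real.exp (m / 2) * unitCall m (S m)) = fun m =>
      Real.exp (m / 2) * Phi (m / (2 * S m) + S m)
        - Real.exp (-m / 2) * Phi (m / (2 * S m) - S m) := by
    funext m
    rw [unitCall, mul_sub, ← mul_assoc, he]
  rw [hfun]
  refine HasDerivAt.congr_deriv h ?_
  simp only [Function.comp, symCallDeriv]
  linear_combination ((S m - m * S₁ m) / (2 * S m ^ 2) + S₁ m) * exp_mul_phi_add m hS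
    - ((S m - m * S₁ m) / (2 * S m ^ 2) - S₁ m) * exp_mul_phi_sub m hS

/-- The exponentials `exp (± m / 2)` both have second derivative a quarter of themselves, so the
`Phi` terms reassemble into a quarter of the original function. -/
lemma hasDerivAt_symCallDeriv {m : ℝ} (hS : S m ≠ 0) (h1 : HasDerivAt S (S₁ m) m)
    (h2 : HasDerivAt S₁ (S₂ m) m) :
    HasDerivAt (symCallDeriv S S₁) (1 / 4 * (Real.exp (m / 2) * unitCall m (S m))
      + (Real.sqrt (2 * Real.pi))⁻¹ * (vegaKernel m (S m) * curvatureFactor S S₁ S₂ m)) m := by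
  have hq := hasDerivAt_quotient hS h1
  have hp : HasDerivAt (fun m => m / (2 * S m) + S m) _ m := hq.add h1
  have hm : HasDerivAt (fun m => m / (2 * S m) - S m) _ m := hq.sub h1
  have h := ((((hasDerivAt_exp_half m).mul ((hasDerivAt_Phi _).comp m hp)).add
    ((hasDerivAt_exp_neg_half m).mul ((hasDerivAt_Phi _).comp m hm))).const_mul (1 / 2)).add
    ((((hasDerivAt_vegaKernel hS h1).const_mul (Real.sqrt (2 * Real.pi))⁻¹).const_mul 2).mul h2)
  have he : Real.exp (m / 2) * Real.exp (-m) = Real.exp (-m / 2) := by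
    rw [← Real.exp_add]; ring_nf
  refine HasDerivAt.congr_deriv (f := symCallDeriv S S₁) h ?_
  simp only [Function.comp, unitCall, mul_sub, ← mul_assoc _ (Real.exp (-m)) _]
  simp only [he]
  have e1 : (S m - m * S₁ m) / (2 * S m ^ 2)
      = 1 / 2 * (S m)⁻¹ - 1 / 2 * (m * S₁ m) * (S m)⁻¹ ^ 2 := by
    field_simp
  rw [e1]
  unfold curvatureFactor
  linear_combination 1 / 2 * (1 / 2 * (S m)⁻¹ - 1 / 2 * (m * S₁ m) * (S m)⁻¹ ^ 2 + S₁ m)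
      * exp_mul_phi_add m hS
    + 1 / 2 * (1 / 2 * (S m)⁻¹ - 1 / 2 * (m * S₁ m) * (S m)⁻¹ ^ 2 - S₁ m) * exp_mul_phi_sub m hS

end

/-- The differential equation obtained from the implicit equation by eliminating `Phi`. -/
lemma vegaKernel_mul_curvatureFactor {N : ℕ} {lam H : Fin N → ℝ} {S S₁ S₂ : ℝ → ℝ}
    (hH : ∀ n, 0 < H n) (hS : ∀ m, 0 < S m) (heq : ∀ m, unitCall m (S m) = unitMix lam H m)
    (h1 : ∀ m, HasDerivAt S (S₁ m) m) (h2 : ∀ m, HasDerivAt S₁ (S₂ m) m) (m : ℝ) :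
    vegaKernel m (S m) * curvatureFactor S S₁ S₂ m
      = ∑ n, lam n * (vegaKernel m (H n) * (1 / 2 * (H n)⁻¹)) := by
  have hfun : (fun m => Real.exp (m / 2) * unitCall m (S m))
      = fun m => ∑ n, lam n * (Real.exp (m / 2) * unitCall m (H n)) := by
    funext m
    rw [heq, unitMix, Finset.mul_sum]
    exact Finset.sum_congr rfl fun n _ => by ring
  -- Each component is the same expression with constant `S`, so the same formulas apply with zero
  -- derivatives.
  have hd1 : symCallDeriv S S₁ = fun m =>
      ∑ n, lam n * symCallDeriv (fun _ => H n) (fun _ => 0) m := by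
    funext m
    have hl := hasDerivAt_symCall (hS m).ne' (h1 m)
    rw [hfun] at hl
    refine hl.unique (HasDerivAt.fun_sum fun n _ => ?_)
    exact (hasDerivAt_symCall (S := fun _ => H n) (S₁ := fun _ => 0) (hH n).ne'
      (hasDerivAt_const m (H n))).const_mul (lam n)
  have hl := hasDerivAt_symCallDeriv (hS m).ne' (h1 m) (h2 m)
  rw [hd1] at hl
  have hd2 := hl.unique (HasDerivAt.fun_sum fun n _ =>
    (hasDerivAt_symCallDeriv (S := fun _ => H n) (S₁ := fun _ => 0) (S₂ := fun _ => 0) (hH n).ne'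
      (hasDerivAt_const m (H n)) (hasDerivAt_const m 0)).const_mul (lam n))
  have hm := congrFun hfun m
  simp only [mul_add, Finset.sum_add_distrib, mul_left_comm (lam _) (1 / 4 : ℝ), ← Finset.mul_sum,
    mul_left_comm (lam _) (Real.sqrt (2 * Real.pi))⁻¹] at hd2
  rw [hm, add_right_inj] at hd2
  have hc : (Real.sqrt (2 * Real.pi))⁻¹ ≠ 0 := by
    have := Real.pi_pos
    positivity
  simpa [curvatureFactor] using mul_left_cancel₀ hc hd2

/-! ### Taylor expansions of even and odd functions. -/

/-- The order-`n` Taylor remainder is `o(x ^ n)`; the term of degree `n` is moved into the error. -/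
lemma taylor_isBigO {f : ℝ → ℝ} (hf : ContDiff ℝ ∞ f) (n : ℕ) :
    (fun x => f x - ∑ k ∈ Finset.range n, iteratedDeriv k f 0 / (k.factorial : ℝ) * x ^ k)
      =O[𝓝 0] fun x => x ^ n := by
  have h := (taylor_isLittleO_univ (x₀ := 0) (hf.of_le (by exact_mod_cast le_top) :
    ContDiff ℝ n f)).isBigO
  have h2 : (fun x : ℝ => iteratedDeriv n f 0 / (n.factorial : ℝ) * x ^ n)
      =O[𝓝 0] fun x => x ^ n := (isBigO_refl _ _).const_mul_left _
  simp only [sub_zero] at h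
  refine (h.add h2).congr_left fun x => ?_
  rw [taylor_within_apply, Finset.sum_range_succ]
  simp only [iteratedDerivWithin_univ, sub_zero, smul_eq_mul]
  have : ∀ k : ℕ, ((k.factorial : ℝ))⁻¹ * x ^ k * iteratedDeriv k f 0
      = iteratedDeriv k f 0 / (k.factorial : ℝ) * x ^ k := fun k => by ring
  simp only [this]
  ring

lemma iteratedDeriv_eq_zero_of_even {f : ℝ → ℝ} (hf : ∀ x, f (-x) = f x) {k : ℕ} (hk : Odd k) :
    iteratedDeriv k f 0 = 0 := by
  have h := iteratedDeriv_comp_neg k f 0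
  simp only [hf, hk.neg_one_pow, neg_zero, smul_eq_mul] at h
  linarith

/-- `f` has the even expansion `a + b x² + c x⁴` at `0`, up to `O(x⁶)`. -/
def EvenJet (f : ℝ → ℝ) (a b c : ℝ) : Prop :=
  (fun x => f x - (a + b * x ^ 2 + c * x ^ 4)) =O[𝓝 0] fun x => x ^ 6

/-- `f` has the odd expansion `b x + c x³` at `0`, up to `O(x⁵)`. -/
def OddJet (f : ℝ → ℝ) (b c : ℝ) : Prop :=
  (fun x => f x - (b * x + c * x ^ 3)) =O[𝓝 0] fun x => x ^ 5

lemma isBigO_of_continuous_mul {g : ℝ → ℝ} (hg : Continuous g) (n : ℕ) :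
    (fun x => g x * x ^ n) =O[𝓝 0] fun x => x ^ n := by
  have h1 : g =O[𝓝 0] fun _ => (1 : ℝ) := hg.continuousAt.isBigO_one ℝ
  simpa using h1.mul (isBigO_refl (fun x : ℝ => x ^ n) (𝓝 0))

namespace EvenJet

variable {f g : ℝ → ℝ} {a b c a' b' c' : ℝ}

lemma const (a : ℝ) : EvenJet (fun _ => a) a 0 0 := by
  simpa [EvenJet] using isBigO_zero _ _

lemma congr_coeffs (h : EvenJet f a b c) (ha : a = a') (hb : b = b') (hc : c = c') :
    EvenJet f a' b' c' := ha ▸ hb ▸ hc ▸ h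

lemma add (hf : EvenJet f a b c) (hg : EvenJet g a' b' c') :
    EvenJet (fun x => f x + g x) (a + a') (b + b') (c + c') :=
  (IsBigO.add hf hg).congr_left fun x => by ring

lemma const_mul (k : ℝ) (hf : EvenJet f a b c) :
    EvenJet (fun x => k * f x) (k * a) (k * b) (k * c) :=
  (IsBigO.const_mul_left hf k).congr_left fun x => by ring

lemma sub (hf : EvenJet f a b c) (hg : EvenJet g a' b' c') :
    EvenJet (fun x => f x - g x) (a - a') (b - b') (c - c') :=
  (IsBigO.sub hf hg).congr_left fun x => by ring

lemma sum {ι : Type*} {s : Finset ι} {f : ι → ℝ → ℝ} {a b c : ι → ℝ}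
    (h : ∀ i ∈ s, EvenJet (f i) (a i) (b i) (c i)) :
    EvenJet (fun x => ∑ i ∈ s, f i x) (∑ i ∈ s, a i) (∑ i ∈ s, b i) (∑ i ∈ s, c i) := by
  refine (IsBigO.fun_sum h).congr_left fun x => ?_
  simp only [Finset.sum_sub_distrib, Finset.sum_add_distrib, Finset.sum_mul]

lemma tendsto (hf : EvenJet f a b c) : Tendsto f (𝓝 0) (𝓝 a) := by
  have h0 : Tendsto (fun x : ℝ => x ^ 6) (𝓝 0) (𝓝 0) :=
    (continuous_pow 6).tendsto' 0 0 (by simp)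
  have h1 := IsBigO.trans_tendsto hf h0
  have h2 : Tendsto (fun x : ℝ => a + b * x ^ 2 + c * x ^ 4) (𝓝 0) (𝓝 a) :=
    Continuous.tendsto' (by fun_prop) 0 a (by simp)
  simpa using h1.add h2

lemma mul (hf : EvenJet f a b c) (hg : EvenJet g a' b' c') :
    EvenJet (fun x => f x * g x) (a * a') (a * b' + b * a') (a * c' + b * b' + c * a') := by
  have h1 : (fun x => (f x - (a + b * x ^ 2 + c * x ^ 4)) * g x) =O[𝓝 0] fun x => x ^ 6 := by
    simpa using IsBigO.mul hf (hg.tendsto.isBigO_one ℝ)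
  have h2 : (fun x => (a + b * x ^ 2 + c * x ^ 4) * (g x - (a' + b' * x ^ 2 + c' * x ^ 4)))
      =O[𝓝 0] fun x => x ^ 6 := by
    have : (fun x : ℝ => a + b * x ^ 2 + c * x ^ 4) =O[𝓝 0] fun _ => (1 : ℝ) :=
      Continuous.continuousAt (by fun_prop) |>.isBigO_one ℝ
    simpa using this.mul hg
  -- The terms of degree 6 and 8 in the product of the two polynomials.
  have h3 := isBigO_of_continuous_mul (g := fun x => b * c' + c * b' + c * c' * x ^ 2)
    (by fun_prop) 6
  exact ((h1.add h2).add h3).congr_left fun x => by ring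

/-- The claimed polynomial times `f` is `1 + O(x ^ 6)`; multiplying the error by the bounded `1 / f`
preserves its order. -/
lemma inv (hf : EvenJet f a b c) (ha : a ≠ 0) :
    EvenJet (fun x => (f x)⁻¹) a⁻¹ (-b * a⁻¹ ^ 2) (b ^ 2 * a⁻¹ ^ 3 - c * a⁻¹ ^ 2) := by
  have hq : EvenJet (fun x => a⁻¹ + -b * a⁻¹ ^ 2 * x ^ 2 + (b ^ 2 * a⁻¹ ^ 3 - c * a⁻¹ ^ 2) * x ^ 4)
      a⁻¹ (-b * a⁻¹ ^ 2) (b ^ 2 * a⁻¹ ^ 3 - c * a⁻¹ ^ 2) := by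
    simpa [EvenJet] using isBigO_zero _ _
  have h1 : EvenJet _ 1 0 0 := (hf.mul hq).congr_coeffs (by field_simp) (by field_simp; ring)
    (by field_simp; ring)
  have h2 : (fun x => (f x)⁻¹) =O[𝓝 0] fun _ => (1 : ℝ) := (hf.tendsto.inv₀ ha).isBigO_one ℝ
  have h3 := (h2.mul h1).neg_left
  simp only [one_mul] at h3
  refine h3.congr' ?_ (EventuallyEq.refl _ _)
  filter_upwards [hf.tendsto.eventually_ne ha] with x hx
  field_simp
  ring

/-- As `f - a = O(x ^ 2)`, the cubic remainder of the exponential is already `O(x ^ 6)`, so its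
quadratic polynomial suffices. -/
lemma exp (hf : EvenJet f a b c) :
    EvenJet (fun x => Real.exp (f x)) (Real.exp a) (Real.exp a * b)
      (Real.exp a * (c + b ^ 2 / 2)) := by
  have h0 : EvenJet (fun x => f x - a) 0 b c :=
    (hf.sub (const a)).congr_coeffs (by ring) (by ring) (by ring)
  have h1 : (fun x => f x - a) =O[𝓝 0] fun x => x ^ 2 := by
    have e1 : (fun x : ℝ => x ^ 6) =O[𝓝 0] fun x => x ^ 2 :=
      (isBigO_of_continuous_mul (g := fun x => x ^ 4) (by fun_prop) 2).congr_left
        fun x => by ring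
    have e2 := isBigO_of_continuous_mul (g := fun x => b + c * x ^ 2) (by fun_prop) 2
    exact ((IsBigO.trans h0 e1).add e2).congr_left fun x => by ring
  have h2 : (fun y : ℝ => Real.exp y - (1 + y + y ^ 2 / 2)) =O[𝓝 0] fun y => y ^ 3 := by
    refine (taylor_isBigO Real.contDiff_exp 3).congr_left fun x => ?_
    simp [Finset.sum_range_succ, iteratedDeriv_eq_iterate]
    ring
  have h3 : (fun x => Real.exp (f x - a) - (1 + (f x - a) + (f x - a) ^ 2 / 2))
      =O[𝓝 0] fun x => x ^ 6 := by
    refine (h2.comp_tendsto h0.tendsto).trans ?_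
    exact (h1.pow 3).congr_right fun x => by ring
  have h4 : EvenJet _ 1 b (c + b ^ 2 / 2) :=
    (((const 1).add h0).add ((h0.mul h0).const_mul (1 / 2))).congr_coeffs
      (by ring) (by ring) (by ring)
  have h5 : EvenJet (fun x => Real.exp (f x - a)) 1 b (c + b ^ 2 / 2) :=
    (h3.add h4).congr_left fun x => by ring
  have h6 : EvenJet _ (Real.exp a) (Real.exp a * b) (Real.exp a * (c + b ^ 2 / 2)) :=
    (h5.const_mul (Real.exp a)).congr_coeffs (by ring) (by ring) (by ring)
  have h7 : ∀ x, Real.exp a * Real.exp (f x - a) = Real.exp (f x) := fun x => by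
    rw [← Real.exp_add]
    ring_nf
  simpa only [h7] using h6

/-- After equating the limits at `0`, divide the difference by `x ^ 2` on the punctured
neighbourhood, let `x → 0`, and repeat. -/
lemma unique (h : EvenJet f a b c) (h' : EvenJet f a' b' c') : a = a' ∧ b = b' ∧ c = c' := by
  have ha := tendsto_nhds_unique h.tendsto h'.tendsto
  subst ha
  have hdiff : (fun x : ℝ => ((b' - b) + (c' - c) * x ^ 2) * x ^ 2) =O[𝓝[≠] 0]
      fun x => x ^ 4 * x ^ 2 :=
    ((IsBigO.sub h h').mono nhdsWithin_le_nhds).congr (fun x => by ring) (fun x => by ring)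
  have cancel : ∀ u v : ℝ → ℝ, (fun x => u x * x ^ 2) =O[𝓝[≠] 0] (fun x => v x * x ^ 2) →
      u =O[𝓝[≠] 0] v := by
    intro u v huv
    refine (huv.mul (isBigO_refl (fun x : ℝ => (x ^ 2)⁻¹) _)).congr' ?_ ?_ <;>
    · filter_upwards [self_mem_nhdsWithin] with x hx
      have : x ≠ 0 := hx
      field_simp
  have hzero : ∀ u : ℝ → ℝ, Continuous u → ∀ n : ℕ, n ≠ 0 → u =O[𝓝[≠] 0] (fun x => x ^ n) →
      u 0 = 0 := by
    intro u hu n hn hO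
    have h0 : Tendsto (fun x : ℝ => x ^ n) (𝓝[≠] 0) (𝓝 0) :=
      ((continuous_pow n).tendsto' 0 0 (by simp [hn])).mono_left nhdsWithin_le_nhds
    exact tendsto_nhds_unique (hu.continuousAt.tendsto.mono_left nhdsWithin_le_nhds)
      (hO.trans_tendsto h0)
  have h1 := cancel _ _ hdiff
  have hb : b' - b = 0 := by simpa using hzero _ (by fun_prop) 4 (by norm_num) h1
  have h2 : (fun _ : ℝ => c' - c) =O[𝓝[≠] 0] fun x => x ^ 2 := by
    refine cancel _ _ (h1.congr (fun x => ?_) (fun x => ?_))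
    · rw [hb]; ring
    · ring
  have hc : c' - c = 0 := hzero _ continuous_const 2 (by norm_num) h2
  exact ⟨rfl, by linarith, by linarith⟩

end EvenJet

lemma OddJet.id : OddJet (fun x => x) 1 0 := by
  simpa [OddJet] using isBigO_zero _ _

/-- Accuracy `O(x ^ 5)` is enough for odd factors, since the other factor contributes another
`O(x)`. -/
lemma OddJet.mul {f g : ℝ → ℝ} {b c b' c' : ℝ} (hf : OddJet f b c) (hg : OddJet g b' c') :
    EvenJet (fun x => f x * g x) 0 (b * b') (b * c' + c * b') := by
  have hx : (fun x : ℝ => x ^ 5) =O[𝓝 0] fun x => x :=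
    (isBigO_of_continuous_mul (g := fun x => x ^ 4) (by fun_prop) 1).congr
      (fun x => by ring) (fun x => by ring)
  have hlin : ∀ b c : ℝ, (fun x : ℝ => b * x + c * x ^ 3) =O[𝓝 0] fun x => x := fun b c =>
    (isBigO_of_continuous_mul (g := fun x => b + c * x ^ 2) (by fun_prop) 1).congr
      (fun x => by ring) (fun x => by ring)
  have hgx : g =O[𝓝 0] fun x => x :=
    ((IsBigO.trans hg hx).add (hlin b' c')).congr_left fun x => by ring
  have h1 := (IsBigO.mul hf hgx).congr_right fun x => show x ^ 5 * x = x ^ 6 by ring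
  have h2 := ((hlin b c).mul hg).congr_right fun x => show x * x ^ 5 = x ^ 6 by ring
  have h3 := isBigO_of_continuous_mul (g := fun _ => c * c') (by fun_prop) 6
  exact ((h1.add h2).add h3).congr_left fun x => by ring

lemma evenJet_of_contDiff {f : ℝ → ℝ} (hf : ContDiff ℝ ∞ f)
    (hodd : ∀ k, Odd k → iteratedDeriv k f 0 = 0) :
    EvenJet f (f 0) (iteratedDeriv 2 f 0 / 2) (iteratedDeriv 4 f 0 / 24) := by
  refine (taylor_isBigO hf 6).congr_left fun x => ?_
  simp [Finset.sum_range_succ, Nat.factorial, hodd 1 (by decide), hodd 3 (by decide),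
    hodd 5 (by decide)]

lemma oddJet_of_contDiff {f : ℝ → ℝ} (hf : ContDiff ℝ ∞ f)
    (heven : ∀ k, Even k → iteratedDeriv k f 0 = 0) :
    OddJet f (iteratedDeriv 1 f 0) (iteratedDeriv 3 f 0 / 6) := by
  have h0 : f 0 = 0 := by simpa using heven 0 (by decide)
  refine (taylor_isBigO hf 5).congr_left fun x => ?_
  simp [Finset.sum_range_succ, Nat.factorial, h0, heven 2 (by decide), heven 4 (by decide)]

/-! ### Coefficients from the differential equation. -/

lemma evenJet_vegaKernel {S : ℝ → ℝ} {a b c : ℝ} (h : EvenJet S a b c) (ha : a ≠ 0) :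
    EvenJet (fun m => vegaKernel m (S m)) (Real.exp (-a ^ 2 / 2))
      (Real.exp (-a ^ 2 / 2) * (-a * b - a⁻¹ ^ 2 / 8))
      (Real.exp (-a ^ 2 / 2) * (-(a * c) - b ^ 2 / 2 + b * a⁻¹ ^ 3 / 4
        + (a * b + a⁻¹ ^ 2 / 8) ^ 2 / 2)) := by
  have hu := h.inv ha
  have hm := OddJet.id.mul OddJet.id
  have h1 := (((h.mul h).const_mul (-1 / 2)).sub ((hm.mul (hu.mul hu)).const_mul (1 / 8))).exp
  have e : ∀ m, -1 / 2 * (S m * S m) - 1 / 8 * (m * m * ((S m)⁻¹ * (S m)⁻¹))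
      = -S m ^ 2 / 2 - m ^ 2 * (S m)⁻¹ ^ 2 / 8 := fun m => by ring
  have e0 : -1 / 2 * (a * a) - 1 / 8 * (0 * (a⁻¹ * a⁻¹)) = -a ^ 2 / 2 := by ring
  simp only [e, e0] at h1
  exact h1.congr_coeffs rfl (by ring) (by ring)

lemma evenJet_vegaKernel_const {H : ℝ} (hH : H ≠ 0) :
    EvenJet (fun m => vegaKernel m H) (Real.exp (-H ^ 2 / 2))
      (-Real.exp (-H ^ 2 / 2) * H⁻¹ ^ 2 / 8) (Real.exp (-H ^ 2 / 2) * H⁻¹ ^ 4 / 128) :=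
  (evenJet_vegaKernel (EvenJet.const H) hH).congr_coeffs rfl (by ring) (by ring)

section

variable {N : ℕ} {lam H E : Fin N → ℝ} {S : ℝ → ℝ}

lemma Phi_impliedVol_zero (hsum : ∑ n, lam n = 1) (h0 : unitCall 0 (S 0) = unitMix lam H 0) :
    Phi (S 0) = ∑ n, lam n * Phi (H n) := by
  have e : ∀ s, unitCall 0 s = 2 * Phi s - 1 := fun s => by
    simp only [unitCall, zero_div, zero_add, zero_sub, Phi_neg, neg_zero, Real.exp_zero]
    ring
  have h1 : unitMix lam H 0 = 2 * (∑ n, lam n * Phi (H n)) - ∑ n, lam n := by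
    rw [unitMix, Finset.mul_sum, ← Finset.sum_sub_distrib]
    exact Finset.sum_congr rfl fun n _ => by rw [e]; ring
  rw [e, h1, hsum] at h0
  linarith

/-- The even derivatives at `0` of half of the total implied volatility of a mixture. -/
lemma iteratedDeriv_impliedVol (hH : ∀ n, 0 < H n) (hS : ∀ m, 0 < S m)
    (heq : ∀ m, unitCall m (S m) = unitMix lam H m) (hsm : ContDiff ℝ ∞ S)
    (heven : ∀ m, S (-m) = S m)
    (hE : ∀ n, E n = Real.exp (1 / 2 * (S 0 ^ 2 - H n ^ 2))) {a b c e M₁ M₃ M₅ : ℝ}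
    (ha : a = S 0) (hb : b = iteratedDeriv 2 S 0) (hc : c = iteratedDeriv 4 S 0)
    (he : e = iteratedDeriv 6 S 0) (hM₁ : M₁ = ∑ n, lam n * (E n / H n))
    (hM₃ : M₃ = ∑ n, lam n * (E n / H n ^ 3)) (hM₅ : M₅ = ∑ n, lam n * (E n / H n ^ 5)) :
    b = 1 / 4 * (-(1 / a) + M₁) ∧
    c = 1 / 16 * ((1 + 6 * (4 * a * b) + a ^ 2 * (-7 - 6 * (4 * a * b) + 3 * (4 * a * b) ^ 2))
      / a ^ 3 + (-M₃ + 7 * M₁)) ∧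
    e = 1 / 64 * ((-3 - 45 * (4 * a * b) + a ^ 2 * (90 * (4 * a * b) + 60 * (4 * a * c))
        + a ^ 4 * (4 * a * b) * (45 * (4 * a * b) + 60 * (4 * a * c) - 15 * (4 * a * b) ^ 2))
        / a ^ 5
      + (16 * a ^ 2 - 90 * (4 * a * b) ^ 2 - 31 * a ^ 4 - 45 * a ^ 2 * (4 * a * b) ^ 2
        - a ^ 4 * (15 * (4 * a * b) + 60 * (4 * a * c)) + 15 * a ^ 2 * (4 * a * b) ^ 3) / a ^ 5
      + (3 * M₅ - 16 * M₃ + 31 * M₁)) := by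
  have ha0 : a ≠ 0 := ha ▸ (hS 0).ne'
  have hodd : ∀ k, Odd k → iteratedDeriv k S 0 = 0 := fun k hk =>
    iteratedDeriv_eq_zero_of_even heven hk
  have hsm1 : ContDiff ℝ ∞ (deriv S) := (contDiff_infty_iff_deriv.1 hsm).2
  have hsm2 : ContDiff ℝ ∞ (deriv (deriv S)) := (contDiff_infty_iff_deriv.1 hsm1).2
  have hj0 : EvenJet S a (b / 2) (c / 24) := by
    simpa only [ha, hb, hc] using evenJet_of_contDiff hsm hodd
  have hj1 : OddJet (deriv S) b (c / 6) := by
    have := oddJet_of_contDiff hsm1 fun k hk => by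
      rw [← iteratedDeriv_succ']; exact hodd _ hk.add_one
    simpa only [← iteratedDeriv_succ', hb, hc] using this
  have hj2 : EvenJet (deriv (deriv S)) b (c / 2) (e / 24) := by
    have := evenJet_of_contDiff hsm2 fun k hk => by
      rw [← iteratedDeriv_succ', ← iteratedDeriv_succ']; exact hodd _ (hk.add_one.add_one)
    have h2 : deriv (deriv S) 0 = b := by rw [hb, iteratedDeriv_succ, iteratedDeriv_one]
    simpa only [← iteratedDeriv_succ', h2, hc, he] using this
  have hu := hj0.inv ha0
  have hm := OddJet.id.mul OddJet.id
  -- Assembled factor by factor in the shape of `curvatureFactor`, so that it expands literally the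
  -- same function as `hright`.
  have hleft := (evenJet_vegaKernel hj0 ha0).mul
    ((((hu.const_mul (1 / 2)).sub ((OddJet.id.mul hj1).mul (hu.mul hu))).add
      ((((hm.const_mul (1 / 2)).mul (hu.mul (hu.mul hu))).sub (hj0.const_mul 2)).mul
        (hj1.mul hj1))).add (hj2.const_mul 2))
  have hright : EvenJet (fun m => ∑ n, lam n * (vegaKernel m (H n) * (1 / 2 * (H n)⁻¹))) _ _ _ :=
    EvenJet.sum fun n _ => ((evenJet_vegaKernel_const (hH n).ne').mul
      (EvenJet.const (1 / 2 * (H n)⁻¹))).const_mul (lam n)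
  have hd : ∀ f : ℝ → ℝ, ContDiff ℝ ∞ f → ∀ m, HasDerivAt f (deriv f m) m := fun f hf m =>
    (hf.differentiable (by simp) m).hasDerivAt
  have hode := vegaKernel_mul_curvatureFactor hH hS heq (hd S hsm) (hd _ hsm1)
  simp only [← hode, curvatureFactor] at hright
  obtain ⟨h0, h2, h4⟩ := hleft.unique hright
  -- Extracting the common factor `exp (-a ^ 2 / 2)` turns the component kernels at `0` into the `E
  -- n`.
  have hexp : ∀ n, Real.exp (-H n ^ 2 / 2) = Real.exp (-a ^ 2 / 2) * E n := fun n => by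
    rw [hE, ha, ← Real.exp_add]
    ring_nf
  have hx : Real.exp (-a ^ 2 / 2) ≠ 0 := (Real.exp_pos _).ne'
  have r0 : ∑ n, lam n * (Real.exp (-H n ^ 2 / 2) * (1 / 2 * (H n)⁻¹))
      = Real.exp (-a ^ 2 / 2) * (M₁ / 2) := by
    rw [hM₁, Finset.sum_div, Finset.mul_sum]
    exact Finset.sum_congr rfl fun n _ => by rw [hexp]; ring
  have r2 : ∑ n, lam n * (Real.exp (-H n ^ 2 / 2) * 0
      + -Real.exp (-H n ^ 2 / 2) * (H n)⁻¹ ^ 2 / 8 * (1 / 2 * (H n)⁻¹))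
      = Real.exp (-a ^ 2 / 2) * (-M₃ / 16) := by
    rw [hM₃, ← Finset.sum_neg_distrib, Finset.sum_div, Finset.mul_sum]
    exact Finset.sum_congr rfl fun n _ => by rw [hexp]; ring
  have r4 : ∑ n, lam n * (Real.exp (-H n ^ 2 / 2) * 0
      + -Real.exp (-H n ^ 2 / 2) * (H n)⁻¹ ^ 2 / 8 * 0
      + Real.exp (-H n ^ 2 / 2) * (H n)⁻¹ ^ 4 / 128 * (1 / 2 * (H n)⁻¹))
      = Real.exp (-a ^ 2 / 2) * (M₅ / 256) := by
    rw [hM₅, Finset.sum_div, Finset.mul_sum]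
    exact Finset.sum_congr rfl fun n _ => by rw [hexp]; ring
  rw [r0] at h0
  rw [r2] at h2
  rw [r4] at h4
  have k0 := mul_left_cancel₀ hx h0
  simp only [mul_assoc (Real.exp _), ← mul_add] at h2 h4
  have k2 := mul_left_cancel₀ hx h2
  have k4 := mul_left_cancel₀ hx h4
  -- The three relations are solved for the sums `M₁, M₃, M₅`, in which they are linear; after
  -- substitution the claims are rational identities in `a, b, c, e`.
  have m1 : M₁ = a⁻¹ + 4 * b := by linear_combination -2 * k0
  have m3 := neg_eq_iff_eq_neg.1 ((eq_div_iff (by norm_num : (16 : ℝ) ≠ 0)).1 k2).symm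
  have m5 := ((eq_div_iff (by norm_num : (256 : ℝ) ≠ 0)).1 k4).symm
  rw [m1, m3, m5]
  refine ⟨?_, ?_, ?_⟩ <;>
  · field_simp
    ring

end

/-! ### Return to Black–Scholes prices, and the theorem. -/

lemma moneyness_add_div {τ σ : ℝ} (hτ : 0 < τ) (hσ : 0 < σ) (m : ℝ) :
    (m + σ ^ 2 * τ / 2) / (σ * Real.sqrt τ)
      = m / (2 * (1 / 2 * σ * Real.sqrt τ)) + 1 / 2 * σ * Real.sqrt τ := by
  have h := Real.sqrt_pos.2 hτ
  have h2 := Real.sq_sqrt hτ.le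
  field_simp
  linear_combination -σ ^ 2 * h2

lemma moneyness_sub_div {τ σ : ℝ} (hτ : 0 < τ) (hσ : 0 < σ) (m : ℝ) :
    (m - σ ^ 2 * τ / 2) / (σ * Real.sqrt τ)
      = m / (2 * (1 / 2 * σ * Real.sqrt τ)) - 1 / 2 * σ * Real.sqrt τ := by
  have h := Real.sqrt_pos.2 hτ
  have h2 := Real.sq_sqrt hτ.le
  field_simp
  linear_combination σ ^ 2 * h2

lemma bsMoneyness_eq {τ σ : ℝ} (hτ : 0 < τ) (hσ : 0 < σ) (S0 m : ℝ) :
    bsMoneyness S0 τ m σ = S0 * unitCall m (1 / 2 * σ * Real.sqrt τ) := by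
  rw [bsMoneyness, moneyness_add_div hτ hσ, moneyness_sub_div hτ hσ, unitCall]

lemma mixMoneyness_eq {N : ℕ} {τ : ℝ} (hτ : 0 < τ) (S0 m : ℝ) (lam : Fin N → ℝ) {η : Fin N → ℝ}
    (hη : ∀ n, 0 < η n) :
    mixMoneyness S0 τ lam η m
      = S0 * unitMix lam (fun n => 1 / 2 * η n * Real.sqrt τ) m := by
  rw [mixMoneyness, unitMix]
  congr 1
  refine Finset.sum_congr rfl fun n _ => ?_
  rw [moneyness_add_div hτ (hη n), moneyness_sub_div hτ (hη n), unitCall]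

lemma mul_exp_neg_logMoneyness {S0 K : ℝ} (hS0 : 0 < S0) (hK : 0 < K) (r t0 T : ℝ) :
    K * Real.exp (-r * (T - t0)) = S0 * Real.exp (-logMoneyness r t0 S0 T K) := by
  rw [logMoneyness, neg_add, Real.exp_add, Real.exp_neg (Real.log _),
    Real.exp_log (div_pos hS0 hK), neg_mul]
  field_simp

/-- Calls and puts differ from the normalized call by a term which does not depend on the
volatility. -/
lemma exists_bsPrice_eq (o : OptionType) {t0 S0 T K : ℝ} (r : ℝ) (hS0 : 0 < S0) (hK : 0 < K)
    (hT : t0 < T) :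
    ∃ c, (∀ σ, 0 < σ → bsPrice o r t0 S0 T K σ
        = S0 * (unitCall (logMoneyness r t0 S0 T K) (1 / 2 * σ * Real.sqrt (T - t0)) - c)) ∧
      bsPrice o r t0 S0 T K 0
        = S0 * (max (1 - Real.exp (-logMoneyness r t0 S0 T K)) 0 - c) := by
  have hτ : 0 < T - t0 := sub_pos.2 hT
  have hKe := mul_exp_neg_logMoneyness hS0 hK r t0 T
  have hp : ∀ σ, 0 < σ → dPlus S0 r (T - t0) K σ = _ := fun σ hσ =>
    (show _ = (logMoneyness r t0 S0 T K + σ ^ 2 * (T - t0) / 2) / (σ * Real.sqrt (T - t0)) by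
      rw [dPlus, logMoneyness]; ring_nf).trans (moneyness_add_div hτ hσ _)
  have hm : ∀ σ, 0 < σ → dMinus S0 r (T - t0) K σ = _ := fun σ hσ =>
    (show _ = (logMoneyness r t0 S0 T K - σ ^ 2 * (T - t0) / 2) / (σ * Real.sqrt (T - t0)) by
      rw [dMinus, logMoneyness]; ring_nf).trans (moneyness_sub_div hτ hσ _)
  cases o with
  | call =>
    refine ⟨0, fun σ hσ => ?_, ?_⟩
    · simp only [bsPrice, hσ.ne', if_false, hp σ hσ, hm σ hσ, hKe, unitCall]
      ring
    · simp only [bsPrice, if_true, hKe, sub_zero]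
      rw [mul_max_of_nonneg _ _ hS0.le]
      ring_nf
  | put =>
    refine ⟨1 - Real.exp (-logMoneyness r t0 S0 T K), fun σ hσ => ?_, ?_⟩
    · simp only [bsPrice, hσ.ne', if_false, hp σ hσ, hm σ hσ, hKe, unitCall, Phi_neg]
      ring
    · simp only [bsPrice, if_true, hKe]
      rw [← max_sub_sub_right, mul_max_of_nonneg _ _ hS0.le, max_comm]
      ring_nf

/-- The weights sum to one, so the volatility-independent shift between the option price and the
normalized call drops out of both sides, for calls and puts alike. The strict intrinsic bound
excludes `σ = 0`. -/
lemma bsPrice_eq_mix_iff (o : OptionType) {t0 S0 T K : ℝ} (r : ℝ) (hS0 : 0 < S0) (hK : 0 < K)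
    (hT : t0 < T) {N : ℕ} {lam η : Fin N → ℝ} (hsum : ∑ n, lam n = 1) (hη : ∀ n, 0 < η n)
    {s : ℝ} (hs : 0 < s)
    (heq : unitCall (logMoneyness r t0 S0 T K) s
      = unitMix lam (fun n => 1 / 2 * η n * Real.sqrt (T - t0)) (logMoneyness r t0 S0 T K))
    (σ : ℝ) :
    (0 ≤ σ ∧ bsPrice o r t0 S0 T K σ = ∑ n, lam n * bsPrice o r t0 S0 T K (η n)) ↔
      σ = 2 / Real.sqrt (T - t0) * s := by
  have hτ : 0 < Real.sqrt (T - t0) := Real.sqrt_pos.2 (sub_pos.2 hT)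
  obtain ⟨c, hc, hc0⟩ := exists_bsPrice_eq o r hS0 hK hT
  have hmix : ∑ n, lam n * bsPrice o r t0 S0 T K (η n)
      = S0 * (unitCall (logMoneyness r t0 S0 T K) s - c) := by
    have : c = ∑ n, lam n * c := by rw [← Finset.sum_mul, hsum, one_mul]
    rw [heq, unitMix, this, ← Finset.sum_sub_distrib, Finset.mul_sum]
    refine Finset.sum_congr rfl fun n _ => ?_
    rw [hc _ (hη n)]
    ring
  rw [hmix]
  constructor
  · rintro ⟨h0, h⟩
    rcases h0.eq_or_lt with rfl | hσ
    · rw [hc0] at h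
      have := mul_left_cancel₀ hS0.ne' h
      linarith [intrinsic_lt_unitCall (logMoneyness r t0 S0 T K) hs]
    · rw [hc σ hσ] at h
      have h1 := mul_left_cancel₀ hS0.ne' h
      rw [← unitCall_injOn (logMoneyness r t0 S0 T K) (by positivity) hs (sub_left_inj.1 h1)]
      field_simp
  · intro h
    have hσ : 0 < σ := by rw [h]; positivity
    refine ⟨hσ.le, ?_⟩
    have : 1 / 2 * σ * Real.sqrt (T - t0) = s := by rw [h]; field_simp
    rw [hc σ hσ, this]

lemma PhiInv_Phi (x : ℝ) : PhiInv (Phi x) = x :=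
  Function.leftInverse_invFun strictMono_Phi.injective x

end RandVol

theorem theorem1 {Ω : Type*} [MeasurableSpace Ω] (Pr : Measure Ω) [IsProbabilityMeasure Pr]
    (r t0 S0 : ℝ) (hS0 : 0 < S0)
    -- the parametrization, and the vector whose `i`-th entry is randomized
    (d : ℕ) (V : RandVol.VolParametrization t0 d) (p : Fin d → ℝ) (i : Fin d)
    -- the absolutely continuous random variable which replaces the `i`-th parameter
    (X : Ω → ℝ) (hX : HasPDF X Pr volume)
    (hXdom : ∀ᵐ w ∂Pr, Function.update p i (X w) ∈ V.domain)
    -- its Gauss quadrature pairs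
    (N : ℕ) (hN : 1 ≤ N) (hmom : ∀ k ≤ 2 * N, Integrable (fun w => X w ^ k) Pr)
    (lam θ : Fin N → ℝ) (hquad : RandVol.IsGaussQuadrature (Pr.map X) N lam θ)
    (hθdom : ∀ n, Function.update p i (θ n) ∈ V.domain)
    -- the expiry and the strike
    (T K : ℝ) (hT : t0 < T) (hK : 0 < K)
    (τ : ℝ) (hτ : τ = T - t0)
    (η : Fin N → ℝ) (hη : ∀ n, η n = V.vol T K (Function.update p i (θ n)))
    (hηpos : ∀ n, 0 < η n) :
    ∃ P : ℝ → ℝ,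
      -- `P` is the unique positive solution of the implicit equation, and it is smooth
      (∀ m, 0 < P m) ∧
      (∀ m, RandVol.bsMoneyness S0 τ m (P m) = RandVol.mixMoneyness S0 τ lam η m) ∧
      (∀ m σ, 0 < σ →
        RandVol.bsMoneyness S0 τ m σ = RandVol.mixMoneyness S0 τ lam η m → σ = P m) ∧
      ContDiff ℝ ∞ P ∧
      -- the discretized randomization at `(T, K)` is the value of `P` at the log-moneyness
      (∀ (o : RandVol.OptionType) (σ : ℝ),
        RandVol.IsDiscretizedRandomizationAt o r S0 V p i lam θ T K σ ↔
          σ = P (RandVol.logMoneyness r t0 S0 T K)) ∧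
      -- the odd-order terms vanish, and the remainder is of order 8
      (∀ k < 8, Odd k → iteratedDeriv k P 0 = 0) ∧
      ((fun m => P m - (P 0 + iteratedDeriv 2 P 0 / (Nat.factorial 2 : ℝ) * m ^ 2
          + iteratedDeriv 4 P 0 / (Nat.factorial 4 : ℝ) * m ^ 4
          + iteratedDeriv 6 P 0 / (Nat.factorial 6 : ℝ) * m ^ 6))
        =O[𝓝 0] fun m => m ^ 8) ∧
      -- the expansion terms
      (∀ (s0 s2 s4 : ℝ) (H E : Fin N → ℝ),
       s0 = 1 / 2 * P 0 * Real.sqrt τ →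
       s2 = P 0 * iteratedDeriv 2 P 0 * τ →
       s4 = P 0 * iteratedDeriv 4 P 0 * τ →
       (∀ n, H n = 1 / 2 * η n * Real.sqrt τ) →
       (∀ n, E n = Real.exp (1 / 2 * (s0 ^ 2 - H n ^ 2))) →
       P 0 = 2 / Real.sqrt τ *
          RandVol.PhiInv (∑ n, lam n * RandVol.Phi (1 / 2 * η n * Real.sqrt τ)) ∧
       iteratedDeriv 2 P 0 = 1 / (2 * Real.sqrt τ) * (-(1 / s0) + ∑ n, lam n * (E n / H n)) ∧
       iteratedDeriv 4 P 0 = 1 / (8 * Real.sqrt τ) *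
          ((1 + 6 * s2 + s0 ^ 2 * (-7 - 6 * s2 + 3 * s2 ^ 2)) / s0 ^ 3
            + ∑ n, lam n * (E n / H n ^ 3 * (-1 + 7 * H n ^ 2))) ∧
       iteratedDeriv 6 P 0 = 1 / (32 * Real.sqrt τ) *
          ((-3 - 45 * s2 + s0 ^ 2 * (90 * s2 + 60 * s4)
              + s0 ^ 4 * s2 * (45 * s2 + 60 * s4 - 15 * s2 ^ 2)) / s0 ^ 5
            + (16 * s0 ^ 2 - 90 * s2 ^ 2 - 31 * s0 ^ 4 - 45 * s0 ^ 2 * s2 ^ 2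
              - s0 ^ 4 * (15 * s2 + 60 * s4) + 15 * s0 ^ 2 * s2 ^ 3) / s0 ^ 5
            + ∑ n, lam n * (E n / H n ^ 5 * (3 - 16 * H n ^ 2 + 31 * H n ^ 4)))) := by
  have hτ0 : 0 < τ := hτ ▸ sub_pos.2 hT
  have hq : 0 < Real.sqrt τ := Real.sqrt_pos.2 hτ0
  have hAEm : AEMeasurable X Pr := hX.aemeasurable
  have : IsProbabilityMeasure (Pr.map X) := Measure.isProbabilityMeasure_map hAEm
  have hmom' : ∀ k ≤ 2 * N, Integrable (fun x : ℝ => x ^ k) (Pr.map X) := fun k hk =>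
    (integrable_map_measure (by fun_prop) hAEm).2 (hmom k hk)
  have hsum := hquad.sum_weights hN hmom'
  have hH : ∀ n, 0 < 1 / 2 * η n * Real.sqrt τ := fun n => by
    have := hηpos n
    positivity
  obtain ⟨S, hS, heq, hsm, heven⟩ :=
    RandVol.exists_impliedVol (hquad.weights_nonneg hmom') hsum hH
  have hscale : ∀ m, 1 / 2 * (2 / Real.sqrt τ * S m) * Real.sqrt τ = S m := fun m => by field_simp
  have hPpos : ∀ m, 0 < 2 / Real.sqrt τ * S m := fun m => mul_pos (by positivity) (hS m)
  have hPsm : ContDiff ℝ ∞ fun m => 2 / Real.sqrt τ * S m := contDiff_const.mul hsm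
  have hderiv : ∀ k, iteratedDeriv k (fun m => 2 / Real.sqrt τ * S m) 0
      = 2 / Real.sqrt τ * iteratedDeriv k S 0 := fun k => by
    rw [iteratedDeriv_const_mul_field]
  have hodd : ∀ k, Odd k → iteratedDeriv k (fun m => 2 / Real.sqrt τ * S m) 0 = 0 := fun k hk =>
    RandVol.iteratedDeriv_eq_zero_of_even (fun m => by rw [heven]) hk
  refine ⟨fun m => 2 / Real.sqrt τ * S m, hPpos, fun m => ?_, fun m σ hσ h => ?_, hPsm,
    fun o σ => ?_, fun k _ hk => hodd k hk, ?_, ?_⟩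
  · rw [RandVol.bsMoneyness_eq hτ0 (hPpos m), RandVol.mixMoneyness_eq hτ0 S0 m lam hηpos,
      hscale, heq]
  · rw [RandVol.bsMoneyness_eq hτ0 hσ, RandVol.mixMoneyness_eq hτ0 S0 m lam hηpos, ← heq] at h
    have hs := RandVol.unitCall_injOn m (by positivity) (hS m) (mul_left_cancel₀ hS0.ne' h)
    simp only [← hs]
    field_simp
  · simp only [RandVol.IsDiscretizedRandomizationAt, RandVol.discretizedPrice, ← hη]
    subst hτ
    exact RandVol.bsPrice_eq_mix_iff o r hS0 hK hT hsum hηpos (hS _) (heq _) σ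
  -- Taylor to degree 7: vanishing of the seventh derivative is what allows the error `O(m ^ 8)`.
  · refine (RandVol.taylor_isBigO hPsm 8).congr_left fun m => ?_
    simp only [Finset.sum_range_succ, Finset.sum_range_zero, hodd 1 (by decide),
      hodd 3 (by decide), hodd 5 (by decide), hodd 7 (by decide), iteratedDeriv_zero]
    simp
  · intro s0 s2 s4 H E hs0 hs2 hs4 hHn hEn
    have hττ := Real.sq_sqrt hτ0.le
    simp only [hderiv] at hs2 hs4 ⊢
    rw [hscale] at hs0
    obtain rfl : H = fun n => 1 / 2 * η n * Real.sqrt τ := funext hHn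
    obtain ⟨h2, h4, h6⟩ := RandVol.iteratedDeriv_impliedVol (E := E) hH hS heq hsm heven
      (fun n => by rw [hEn, hs0]) hs0 rfl rfl rfl rfl rfl rfl
    -- Two factors `2 / √τ` multiplied by `τ` give the 4.
    have e2 : s2 = 4 * s0 * iteratedDeriv 2 S 0 := by
      rw [hs2, hs0]
      field_simp
      linear_combination (-4 * S 0 * iteratedDeriv 2 S 0) * hττ
    have e4 : s4 = 4 * s0 * iteratedDeriv 4 S 0 := by
      rw [hs4, hs0]
      field_simp
      linear_combination (-4 * S 0 * iteratedDeriv 4 S 0) * hττ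
    rw [← e2] at h4
    rw [← e2, ← e4] at h6
    refine ⟨?_, ?_, ?_, ?_⟩
    · rw [← RandVol.Phi_impliedVol_zero hsum (heq 0), RandVol.PhiInv_Phi]
    · rw [h2]
      ring
    · have hs : ∑ n, lam n * (E n / (1 / 2 * η n * Real.sqrt τ) ^ 3
            * (-1 + 7 * (1 / 2 * η n * Real.sqrt τ) ^ 2))
          = -∑ n, lam n * (E n / (1 / 2 * η n * Real.sqrt τ) ^ 3)
            + 7 * ∑ n, lam n * (E n / (1 / 2 * η n * Real.sqrt τ)) := by
        rw [Finset.mul_sum, ← Finset.sum_neg_distrib, ← Finset.sum_add_distrib]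
        refine Finset.sum_congr rfl fun n _ => ?_
        have := (hηpos n).ne'
        field_simp
      rw [hs, h4]
      ring
    · have hs : ∑ n, lam n * (E n / (1 / 2 * η n * Real.sqrt τ) ^ 5
            * (3 - 16 * (1 / 2 * η n * Real.sqrt τ) ^ 2 + 31 * (1 / 2 * η n * Real.sqrt τ) ^ 4))
          = 3 * ∑ n, lam n * (E n / (1 / 2 * η n * Real.sqrt τ) ^ 5)
            - 16 * ∑ n, lam n * (E n / (1 / 2 * η n * Real.sqrt τ) ^ 3)
            + 31 * ∑ n, lam n * (E n / (1 / 2 * η n * Real.sqrt τ)) := by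
        rw [Finset.mul_sum, Finset.mul_sum, Finset.mul_sum, ← Finset.sum_sub_distrib,
          ← Finset.sum_add_distrib]
        refine Finset.sum_congr rfl fun n _ => ?_
        -- Naming the half total volatility makes it an atom for `field_simp`.
        obtain ⟨h, hh⟩ : ∃ h, h = 1 / 2 * η n * Real.sqrt τ := ⟨_, rfl⟩
        have : h ≠ 0 := hh ▸ (hH n).ne'
        rw [← hh]
        field_simp
      rw [hs, h6]
      ring
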